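/- Let $s\in\mathbb N$, let $U=(u_{ij})$ be an $s\times s$ complex unitary matrix, and let $r_1,\dots,r_s\in\mathbb R$. Consider the following Gaussian boson sampling circuit on $s$ modes, each with Hilbert space $L^2(\mathbb R)$ and Fock basis $|n\rangle=\psi_n$, $n\in\mathbb N$, where $\psi_n(x)=(2^n n!\sqrt\pi)^{-1/2}H_n(x)e^{-x^2/2}$ is the $n$-th Hermite function. * Input: mode $j$ is prepared in the squeezed vacuum $S(r_j)|0\rangle$, where $(S(r)f)(x)=e^{r/2}f(e^{r}x)$. * Interferometer with matrix $U$: each input $j$ enters a W node $\sum_{k_1,\dots,k_s\ge 0}\sqrt{\frac{(\sum_i k_i)!}{\prod_i k_i!}}\,|k_1,\dots,k_s\rangle\langle\sum_i k_i|$; its $i$-th output leg passes through the Fock spider $u_{ij}^{\hat n}=\sum_{k\ge0}u_{ij}^{k}|k\rangle\langle k|$ (with $0^0=1$) and then enters, as the $j$-th leg, the transposed W node $\sum_{k_1,\dots,k_s\ge 0}\sqrt{\frac{(\sum_j k_j)!}{\prod_j k_j!}}\,|\sum_j k_j\rangle\langle k_1,\dots,k_s|$ of output mode $i$. * Output: photon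 counts $n_1,\dots,n_s$ are observed, i.e. the output modes are projected onto $\langle n_1,\dots,n_s|$. The amplitude is the contraction of this diagram in the Fock basis, i.e. the sum, over all labellings of the internal wires by natural numbers, of the products of the matrix elements of all nodes. If $n_1,\dots,n_s\in\{0,1\}$, then this sum converges absolutely, and the amplitude of observing $n_1,\dots,n_s$ photons equals $$\Bigl(\prod_{j=1}^s\frac1{\sqrt{\cosh r_j}}\Bigr)\,\mathsf{haf}(A_n),\qquad A=-\,U\,\mathrm{diag}(\tanh r_1,\dots,\tanh r_s)\,U^{T},$$ where $A_n$ is the submatrix of the weighted adjacency matrix $A$ obtained by deleting the $i$-th row and column for every $i$ with $n_i=0$. Here the hafnian of a symmetric matrix $B=(b_{ij})$ is $\mathsf{haf}(B)=\sum_{\rho}\prod_{\{i,j\}\in\rho}b_{ij}$, the sum being over all partitions $\rho$ of the index set into two-element subsets (so it is $0$ for odd size and $1$ for the empty matrix). -/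

import Mathlib

open scoped Nat Matrix

noncomputable section

namespace GBS

/-! ## Fock basis and squeezed vacuum in `L²(ℝ)` -/

/-- The physicists' Hermite polynomials `H_n`, as functions on `ℝ`. -/
def hermiteH : ℕ → ℝ → ℝ
  | 0, _ => 1
  | 1, x => 2 * x
  | (n + 2), x => 2 * x * hermiteH (n + 1) x - 2 * ((n : ℝ) + 1) * hermiteH n x

/-- The `n`-th Hermite function `ψ_n`, i.e. the position wave function of the number state `|n⟩`. -/
def hermiteFun (n : ℕ) (x : ℝ) : ℝ :=
  (Real.sqrt ((2 : ℝ) ^ n * (n ! : ℝ) * Real.sqrt Real.pi))⁻¹ *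
    hermiteH n x * Real.exp (-x ^ 2 / 2)

/-- The Fock coefficient `⟨n|f⟩` of a wave function `f` (the Hermite functions are real). -/
def fockCoeff (n : ℕ) (f : ℝ → ℂ) : ℂ :=
  ∫ x : ℝ, (hermiteFun n x : ℂ) * f x

/-- The squeeze gate `S(r)`: the unitary rescaling of the position coordinate,
`|x⟩ ↦ e^{-r/2} |e^{-r} x⟩`. -/
def squeeze (r : ℝ) (f : ℝ → ℂ) : ℝ → ℂ :=
  fun x => (Real.exp (r / 2) : ℂ) * f (Real.exp r * x)

/-- The vacuum state `|0⟩`. -/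
def vacuum : ℝ → ℂ := fun x => (hermiteFun 0 x : ℂ)

/-- The squeezed vacuum state `S(r)|0⟩`. -/
def squeezedVacuum (r : ℝ) : ℝ → ℂ := squeeze r vacuum

/-! ## Nodes of diagrams: their matrix elements in the Fock basis -/

/-- The W node with legs `ι`: its matrix element `⟨N| W |n⟩` (and, for the transposed node,
`⟨n| Wᵀ |N⟩`), which is `√(N! / ∏ nᵢ!)` if `N = ∑ nᵢ`, and `0` otherwise. -/
def wNode {ι : Type*} [Fintype ι] (N : ℕ) (n : ι → ℕ) : ℂ :=
  if N = ∑ i, n i then (Real.sqrt ((N ! : ℝ) / ∏ i, ((n i)! : ℝ)) : ℂ) else 0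

/-- The Fock spider with one input and one output labelled by `g`, i.e. `∑ₙ g(n) |n⟩⟨n|`:
its matrix element `⟨b| · |a⟩`. -/
def fockSpider (g : ℕ → ℂ) (b a : ℕ) : ℂ :=
  if b = a then g a else 0

/-! ## The Gaussian boson sampling circuit -/

/-- Labels (in the Fock basis) of the internal wires of the circuit on `s` modes. -/
structure WireLabels (s : ℕ) where
  /-- the wire from the `j`-th squeezed vacuum to the `j`-th input W node -/
  input : Fin s → ℕ
  /-- `pre i j`: the wire from the `j`-th input W node to the Fock spider on the edge from input
  `j` to output `i` -/
  pre : Fin s → Fin s → ℕ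
  /-- `post i j`: the wire from the Fock spider on the edge from input `j` to output `i` to the
  `i`-th output W node -/
  post : Fin s → Fin s → ℕ

/-- The product of the matrix elements of all nodes of the circuit for one labelling of its
internal wires, when the number states `n 0, …, n (s - 1)` are observed at the outputs.
The inputs are the squeezed vacua with parameters `r j`; the interferometer with matrix `U` consists
of one W node for each input, one W node for each output, and a Fock spider labelled by
`k ↦ (U i j) ^ k` on the edge from input `j` to output `i`. -/
def gbsTerm {s : ℕ} (U : Matrix (Fin s) (Fin s) ℂ) (r : Fin s → ℝ) (n : Fin s → ℕ)
    (w : WireLabels s) : ℂ :=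
  (∏ j, fockCoeff (w.input j) (squeezedVacuum (r j))) *
  (∏ j, wNode (w.input j) (fun i => w.pre i j)) *
  (∏ i, ∏ j, fockSpider (fun k => U i j ^ k) (w.post i j) (w.pre i j)) *
  (∏ i, wNode (n i) (fun j => w.post i j))

/-- The amplitude of observing photon counts `n`: the contraction of the circuit, that is, the sum
over all labellings of its internal wires. -/
def gbsAmplitude {s : ℕ} (U : Matrix (Fin s) (Fin s) ℂ) (r : Fin s → ℝ) (n : Fin s → ℕ) : ℂ :=
  ∑' w : WireLabels s, gbsTerm U r n w

/-- The weighted adjacency matrix `-U (⨁ⱼ tanh rⱼ) Uᵀ` attached to the circuit. -/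
def gbsMatrix {s : ℕ} (U : Matrix (Fin s) (Fin s) ℂ) (r : Fin s → ℝ) :
    Matrix (Fin s) (Fin s) ℂ :=
  -(U * Matrix.diagonal (fun j => (Real.tanh (r j) : ℂ)) * Uᵀ)

/-! ## The hafnian -/

/-- The entry `A i j` attached to a two-element set `p = {i, j}` with `i < j`
(the sum has exactly this one term). -/
def pairEntry {ι : Type*} [LinearOrder ι] (A : Matrix ι ι ℂ) (p : Finset ι) : ℂ :=
  ∑ e ∈ p ×ˢ p with e.1 < e.2, A e.1 e.2

/-- The hafnian of a symmetric matrix: the sum over all partitions of the index set into two-element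
sets of the product of the corresponding entries. It vanishes for index sets of odd size. -/
def hafnian {ι : Type*} [Fintype ι] [LinearOrder ι] (A : Matrix ι ι ℂ) : ℂ :=
  ∑ ρ : Finpartition (Finset.univ : Finset ι) with ∀ p ∈ ρ.parts, p.card = 2,
    ∏ p ∈ ρ.parts, pairEntry A p

/-- The submatrix obtained by deleting row and column `i` for every `i` with `n i = 0`. -/
def deleteZero {s : ℕ} (A : Matrix (Fin s) (Fin s) ℂ) (n : Fin s → ℕ) :
    Matrix {i : Fin s // n i ≠ 0} {i : Fin s // n i ≠ 0} ℂ :=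
  A.submatrix Subtype.val Subtype.val

end GBS

end

open scoped Nat Matrix

noncomputable section

namespace GBS

/-! A detected mode holds exactly one photon, so its output W node forces one incoming leg to carry
1 and the others 0. Nonzero labellings are therefore maps `f` from detected modes to inputs: the sum
is finite, hence absolutely convergent. All edge factorials are 1, so if `f` has `m` preimages over
input `j`, the input W node contributes `√(m!)`. The squeezed vacuum satisfies `⟨m|S(r)|0⟩ √(m!) =
d_m / √(cosh r)`, where `d_m` are the moments of a centred Gaussian of variance `-tanh r`
(`fockCoeff_squeezedVacuum_mul_sqrt_factorial`).

Up to the `cosh` factors the amplitude is thus the expectation of `∏ᵢ ∑ⱼ Uᵢⱼ Xⱼ` over detected `i`,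
with independent `Xⱼ` of variance `-tanh rⱼ`. Wick's theorem (`gaussianExpectation_prod_linearForm`)
makes it the hafnian of the covariance matrix `A_n`. Variances may be negative, so the expectation
is a formal linear functional on polynomials. -/

variable {ι κ : Type*}

/-! ## The recurrence for the hafnian -/

/-- The hafnian of the principal submatrix of `A` with rows and columns in `S`. -/
def hafnianOn [LinearOrder ι] (A : Matrix ι ι ℂ) (S : Finset ι) : ℂ :=
  ∑ ρ : Finpartition S with ∀ p ∈ ρ.parts, p.card = 2, ∏ p ∈ ρ.parts, pairEntry A p

theorem hafnian_eq_hafnianOn [Fintype ι] [LinearOrder ι] (A : Matrix ι ι ℂ) :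
    hafnian A = hafnianOn A Finset.univ := by
  unfold hafnian hafnianOn
  congr

theorem hafnianOn_empty [LinearOrder ι] (A : Matrix ι ι ℂ) : hafnianOn A ∅ = 1 := by
  have key : ∀ ρ : Finpartition (∅ : Finset ι), ρ.parts = ∅ := fun ρ =>
    Finpartition.parts_eq_empty_iff.2 rfl
  have : Subsingleton (Finpartition (∅ : Finset ι)) :=
    ⟨fun P Q => Finpartition.ext (by rw [key P, key Q])⟩
  unfold hafnianOn
  rw [Finset.filter_true_of_mem (fun ρ _ p hp => by simp [key ρ] at hp),
    Finset.sum_congr rfl (fun ρ _ => by rw [key ρ, Finset.prod_empty]), Finset.sum_const,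
    Finset.card_univ,
    show Fintype.card (Finpartition (∅ : Finset ι)) = 1 from Fintype.card_eq_one_iff.2
      ⟨Finpartition.empty (Finset ι), fun ρ => Subsingleton.elim _ _⟩, one_smul]

/-- `pairEntry` reads the entry above the diagonal; symmetry removes the dependence on the order of
`a` and `b`. -/
theorem pairEntry_pair [LinearOrder ι] {A : Matrix ι ι ℂ} (hA : ∀ i j, A i j = A j i) {a b : ι}
    (hab : a ≠ b) : pairEntry A {a, b} = A a b := by
  unfold pairEntry
  rcases lt_or_gt_of_ne hab with h | h
  · have : (({a, b} : Finset ι) ×ˢ ({a, b} : Finset ι)).filter (fun e => e.1 < e.2) = {(a, b)} := by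
      ext ⟨x, y⟩
      simp only [Finset.mem_filter, Finset.mem_product, Finset.mem_insert, Finset.mem_singleton,
        Prod.mk.injEq]
      constructor
      · rintro ⟨⟨rfl | rfl, rfl | rfl⟩, hxy⟩ <;> simp_all [not_lt_of_gt]
      · rintro ⟨rfl, rfl⟩; simp [h]
    rw [this, Finset.sum_singleton]
  · have : (({a, b} : Finset ι) ×ˢ ({a, b} : Finset ι)).filter (fun e => e.1 < e.2) = {(b, a)} := by
      ext ⟨x, y⟩
      simp only [Finset.mem_filter, Finset.mem_product, Finset.mem_insert, Finset.mem_singleton,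
        Prod.mk.injEq]
      constructor
      · rintro ⟨⟨rfl | rfl, rfl | rfl⟩, hxy⟩ <;> simp_all [not_lt_of_gt]
      · rintro ⟨rfl, rfl⟩; simp [h]
    rw [this, Finset.sum_singleton, hA]

/-- Parts are disjoint, so removing one leaves a partition of its complement; this inverts
`extendPair`. -/
theorem sup_parts_erase [DecidableEq ι] {S p : Finset ι} (ρ : Finpartition S) (hp : p ∈ ρ.parts) :
    (ρ.parts.erase p).sup id = S \ p := by
  ext x
  simp only [Finset.mem_sup, Finset.mem_erase, id, Finset.mem_sdiff]
  constructor
  · rintro ⟨q, ⟨hqp, hq⟩, hx⟩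
    exact ⟨ρ.le hq hx, fun hxp => hqp (ρ.eq_of_mem_parts hq hp hx hxp)⟩
  · rintro ⟨hxS, hxp⟩
    obtain ⟨q, hq, hx⟩ := ρ.exists_mem hxS
    exact ⟨q, ⟨fun h => hxp (h ▸ hx), hq⟩, hx⟩

/-- Add a two-element part `{a, b} ⊆ S` to a partition of its complement in `S`. -/
def extendPair [DecidableEq ι] {S : Finset ι} {a b : ι} (ha : a ∈ S) (hb : b ∈ S)
    (σ : Finpartition (S \ {a, b})) : Finpartition S :=
  σ.extend (b := {a, b}) (Finset.insert_ne_empty _ _) Finset.sdiff_disjoint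
    (Finset.sdiff_union_of_subset (by
      intro x hx
      rcases Finset.mem_insert.1 hx with rfl | hx
      · exact ha
      · exact Finset.mem_singleton.1 hx ▸ hb))

theorem extendPair_parts [DecidableEq ι] {S : Finset ι} {a b : ι} (ha : a ∈ S) (hb : b ∈ S)
    (σ : Finpartition (S \ {a, b})) : (extendPair ha hb σ).parts = insert {a, b} σ.parts := rfl

theorem pair_notMem_parts [DecidableEq ι] {S : Finset ι} {a b : ι}
    (σ : Finpartition (S \ {a, b})) : {a, b} ∉ σ.parts := fun h => by
  have := σ.le h (Finset.mem_insert_self a {b})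
  simp at this

/-- Expansion of the hafnian along the row `a`. -/
theorem hafnianOn_eq_sum [LinearOrder ι] {A : Matrix ι ι ℂ} (hA : ∀ i j, A i j = A j i)
    {S : Finset ι} {a : ι} (ha : a ∈ S) :
    hafnianOn A S = ∑ b ∈ S.erase a, A a b * hafnianOn A (S \ {a, b}) := by
  simp_rw [hafnianOn, Finset.mul_sum]
  rw [Finset.sum_sigma']
  symm
  refine Finset.sum_bij
    (fun x hx => extendPair ha (Finset.mem_of_mem_erase (Finset.mem_sigma.1 hx).1) x.2) ?_ ?_ ?_ ?_
  · rintro ⟨b, σ⟩ hx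
    simp only [Finset.mem_sigma, Finset.mem_filter, Finset.mem_univ, true_and,
      Finset.mem_erase] at hx ⊢
    intro p hp
    rw [extendPair_parts] at hp
    rcases Finset.mem_insert.1 hp with rfl | hp
    · exact Finset.card_pair hx.1.1.symm
    · exact hx.2 p hp
  · rintro ⟨b, σ⟩ hx ⟨b', σ'⟩ hx' h
    simp only [Finset.mem_sigma, Finset.mem_erase] at hx hx'
    have hp : insert {a, b} σ.parts = insert {a, b'} σ'.parts := congrArg Finpartition.parts h
    -- Both pairs are parts containing `a`, hence the same part.
    have hbb : b = b' := by
      have h1 : ({a, b} : Finset ι) ∈ (extendPair ha hx'.1.2 σ').parts := by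
        rw [extendPair_parts, ← hp]; exact Finset.mem_insert_self _ _
      have h2 : ({a, b'} : Finset ι) ∈ (extendPair ha hx'.1.2 σ').parts := by
        rw [extendPair_parts]; exact Finset.mem_insert_self _ _
      have h3 := Finpartition.eq_of_mem_parts _ h1 h2 (a := a) (by simp) (by simp)
      have h4 : b ∈ ({a, b'} : Finset ι) := h3 ▸ (by simp)
      simpa [hx.1.1] using h4
    subst hbb
    congr 1
    apply Finpartition.ext
    have := congrArg (fun t => Finset.erase t {a, b}) hp
    simpa [Finset.erase_insert (pair_notMem_parts σ),
      Finset.erase_insert (pair_notMem_parts σ')] using this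
  · intro ρ hρ
    simp only [Finset.mem_filter, Finset.mem_univ, true_and] at hρ
    -- Surjectivity: the part of `ρ` containing `a` determines its partner `b`, and the remaining
    -- parts form `σ`.
    obtain ⟨p, hp, hap⟩ := ρ.exists_mem ha
    obtain ⟨b, hab, rfl⟩ : ∃ b, a ≠ b ∧ p = {a, b} := by
      obtain ⟨x, y, hxy, rfl⟩ := Finset.card_eq_two.1 (hρ p hp)
      simp only [Finset.mem_insert, Finset.mem_singleton] at hap
      rcases hap with rfl | rfl
      · exact ⟨y, hxy, rfl⟩
      · exact ⟨x, hxy.symm, Finset.pair_comm _ _⟩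
    have hb : b ∈ S := ρ.le hp (by simp)
    refine ⟨⟨b, ρ.ofSubset (Finset.erase_subset {a, b} _) (sup_parts_erase ρ hp)⟩, ?_, ?_⟩
    · simp only [Finset.mem_sigma, Finset.mem_erase, Finset.mem_filter, Finset.mem_univ, true_and]
      exact ⟨⟨hab.symm, hb⟩, fun q hq => hρ q (Finset.mem_of_mem_erase hq)⟩
    · apply Finpartition.ext
      rw [extendPair_parts]
      exact Finset.insert_erase hp
  · rintro ⟨b, σ⟩ hx
    simp only [Finset.mem_sigma, Finset.mem_erase] at hx
    rw [extendPair_parts, Finset.prod_insert (pair_notMem_parts σ),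
      pairEntry_pair hA hx.1.1.symm]

/-! ## Fock coefficients of the squeezed vacuum -/

theorem exists_polynomial_hermiteH (n : ℕ) :
    ∃ p : Polynomial ℝ, ∀ x, hermiteH n x = p.eval x := by
  induction n using Nat.twoStepInduction with
  | zero => exact ⟨1, fun x => by simp [hermiteH]⟩
  | one => exact ⟨2 * Polynomial.X, fun x => by simp [hermiteH]⟩
  | more n h0 h1 =>
    obtain ⟨p, hp⟩ := h0
    obtain ⟨q, hq⟩ := h1
    exact ⟨2 * Polynomial.X * q - Polynomial.C (2 * ((n : ℝ) + 1)) * p, fun x => by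
      simp [hermiteH, hp, hq]⟩

theorem integrable_polynomial_mul_gaussian {b : ℝ} (hb : 0 < b) (p : Polynomial ℝ) :
    MeasureTheory.Integrable (fun x : ℝ => p.eval x * Real.exp (-b * x ^ 2)) := by
  induction p using Polynomial.induction_on' with
  | add p q hp hq =>
    simp_rw [Polynomial.eval_add, add_mul]
    exact hp.add hq
  | monomial n c =>
    have := (integrable_rpow_mul_exp_neg_mul_sq hb (s := n)
      (by have : (0 : ℝ) ≤ n := n.cast_nonneg
          linarith)).const_mul c
    simpa [mul_assoc] using this

theorem integrable_hermiteH_mul_gaussian {b : ℝ} (hb : 0 < b) (n : ℕ) :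
    MeasureTheory.Integrable (fun x : ℝ => hermiteH n x * Real.exp (-b * x ^ 2)) := by
  obtain ⟨p, hp⟩ := exists_polynomial_hermiteH n
  simpa [hp] using integrable_polynomial_mul_gaussian hb p

theorem integrable_mul_hermiteH_mul_gaussian {b : ℝ} (hb : 0 < b) (n : ℕ) :
    MeasureTheory.Integrable (fun x : ℝ => x * hermiteH n x * Real.exp (-b * x ^ 2)) := by
  obtain ⟨p, hp⟩ := exists_polynomial_hermiteH n
  exact (integrable_polynomial_mul_gaussian hb (Polynomial.X * p)).congr
    (Filter.Eventually.of_forall fun x => by simp [hp])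

/-- Differentiate the three-term recurrence; the derivatives of the two earlier polynomials
recombine, by the same recurrence one step lower, into a multiple of a single Hermite polynomial. -/
theorem hasDerivAt_hermiteH_succ (n : ℕ) (x : ℝ) :
    HasDerivAt (hermiteH (n + 1)) (2 * ((n : ℝ) + 1) * hermiteH n x) x := by
  induction n using Nat.twoStepInduction with
  | zero =>
    have : hermiteH (0 + 1) = fun x => 2 * x := rfl
    rw [this]
    simpa [hermiteH] using (hasDerivAt_id x).const_mul (2 : ℝ)
  | one =>
    have : hermiteH (1 + 1) = fun x => 2 * x * (2 * x) - 2 * (((0 : ℕ) : ℝ) + 1) * 1 := rfl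
    rw [this]
    have h := (hasDerivAt_id' x).const_mul (2 : ℝ)
    exact ((h.mul h).sub_const (2 * (((0 : ℕ) : ℝ) + 1) * 1)).congr_deriv
      (by simp only [hermiteH]; push_cast; ring)
  | more n h0 h1 =>
    have : hermiteH (n + 2 + 1) = fun x =>
      2 * x * hermiteH (n + 2) x - 2 * (((n + 1 : ℕ) : ℝ) + 1) * hermiteH (n + 1) x := rfl
    rw [this]
    have h := (hasDerivAt_id' x).const_mul (2 : ℝ)
    exact ((h.mul h1).sub (h0.const_mul (2 * (((n + 1 : ℕ) : ℝ) + 1)))).congr_deriv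
      (by simp only [hermiteH]; push_cast; ring)

theorem hasDerivAt_gaussian (b x : ℝ) :
    HasDerivAt (fun x : ℝ => Real.exp (-b * x ^ 2)) (-(2 * b * x) * Real.exp (-b * x ^ 2)) x := by
  exact (((hasDerivAt_id' x).fun_pow 2).const_mul (-b)).exp.congr_deriv (by push_cast; ring)

/-- The moments `∫ H_n(x) e^{-b x²} dx`. -/
def hermiteMoment (b : ℝ) (n : ℕ) : ℝ := ∫ x : ℝ, hermiteH n x * Real.exp (-b * x ^ 2)

theorem hermiteMoment_zero (b : ℝ) : hermiteMoment b 0 = √(Real.pi / b) := by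
  simpa [hermiteMoment, hermiteH] using integral_gaussian b

theorem hermiteMoment_one {b : ℝ} (hb : 0 < b) : hermiteMoment b 1 = 0 := by
  have h := MeasureTheory.integral_eq_zero_of_hasDerivAt_of_integrable
    (fun x => hasDerivAt_gaussian b x)
    (by simpa [hermiteH, mul_assoc] using
      ((integrable_mul_hermiteH_mul_gaussian hb 0).const_mul (2 * b)).neg)
    (by simpa [hermiteH] using integrable_hermiteH_mul_gaussian hb 0)
  have h2 : ∀ x : ℝ, -(2 * b * x) * Real.exp (-b * x ^ 2) =
      (-b) * (hermiteH 1 x * Real.exp (-b * x ^ 2)) := fun x => by simp only [hermiteH]; ring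
  simp_rw [h2, MeasureTheory.integral_const_mul] at h
  exact (mul_eq_zero.1 h).resolve_left (neg_ne_zero.2 hb.ne')

/-- The derivative of `H_{n+1}(x) e^{-b x²}` integrates to 0, which expresses `∫ x H_{n+1} e^{-b
x²}` through the `n`-th moment. Integrating the three-term recurrence then gives the claim. -/
theorem hermiteMoment_add_two {b : ℝ} (hb : 0 < b) (n : ℕ) :
    hermiteMoment b (n + 2) = 2 * ((n : ℝ) + 1) * (1 / b - 1) * hermiteMoment b n := by
  have i0 := integrable_hermiteH_mul_gaussian hb n
  have i1 := integrable_hermiteH_mul_gaussian hb (n + 1)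
  have ix := integrable_mul_hermiteH_mul_gaussian hb (n + 1)
  have e : ∀ x : ℝ, 2 * ((n : ℝ) + 1) * hermiteH n x * Real.exp (-b * x ^ 2) +
      hermiteH (n + 1) x * (-(2 * b * x) * Real.exp (-b * x ^ 2)) =
      2 * ((n : ℝ) + 1) * (hermiteH n x * Real.exp (-b * x ^ 2)) -
        2 * b * (x * hermiteH (n + 1) x * Real.exp (-b * x ^ 2)) := fun x => by ring
  have h := MeasureTheory.integral_eq_zero_of_hasDerivAt_of_integrable
    (fun x => (hasDerivAt_hermiteH_succ n x).mul (hasDerivAt_gaussian b x))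
    (by simp_rw [e]; exact (i0.const_mul _).sub (ix.const_mul _)) i1
  simp_rw [e] at h
  rw [MeasureTheory.integral_sub (i0.const_mul _) (ix.const_mul _),
    MeasureTheory.integral_const_mul, MeasureTheory.integral_const_mul] at h
  have e2 : ∀ x : ℝ, hermiteH (n + 2) x * Real.exp (-b * x ^ 2) =
      2 * (x * hermiteH (n + 1) x * Real.exp (-b * x ^ 2)) -
        2 * ((n : ℝ) + 1) * (hermiteH n x * Real.exp (-b * x ^ 2)) := fun x => by
    simp only [hermiteH]; ring
  simp only [hermiteMoment]
  simp_rw [e2]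
  rw [MeasureTheory.integral_sub (ix.const_mul _) (i0.const_mul _),
    MeasureTheory.integral_const_mul, MeasureTheory.integral_const_mul]
  have h3 : (∫ x : ℝ, x * hermiteH (n + 1) x * Real.exp (-b * x ^ 2)) =
      ((n : ℝ) + 1) / b * ∫ x : ℝ, hermiteH n x * Real.exp (-b * x ^ 2) := by
    rw [div_mul_eq_mul_div, eq_div_iff hb.ne']
    linarith
  rw [h3]
  ring

/-- The sequence `d` with `d 0 = 1`, `d 1 = 0` and `d (m + 2) = (m + 1) c d m`: the moments of a
centred Gaussian of variance `c`. -/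
def gaussianMoment (c : ℂ) : ℕ → ℂ
  | 0 => 1
  | 1 => 0
  | (m + 2) => ((m : ℂ) + 1) * c * gaussianMoment c m

theorem fockCoeff_squeezedVacuum (r : ℝ) (m : ℕ) :
    fockCoeff m (squeezedVacuum r) =
      (((√((2 : ℝ) ^ m * (m ! : ℝ) * √Real.pi))⁻¹ * Real.exp (r / 2) * (√(√Real.pi))⁻¹ *
        hermiteMoment ((1 + Real.exp r ^ 2) / 2) m : ℝ) : ℂ) := by
  rw [fockCoeff, hermiteMoment, ← MeasureTheory.integral_const_mul, ← integral_complex_ofReal]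
  congr 1
  ext x
  simp only [squeezedVacuum, squeeze, vacuum, hermiteFun, hermiteH]
  -- The exponent `b = (1 + e^{2r}) / 2` merges the Gaussian of `ψ_m` with that of the rescaled
  -- vacuum.
  have : Real.exp (-((1 + Real.exp r ^ 2) / 2) * x ^ 2) =
      Real.exp (-x ^ 2 / 2) * Real.exp (-(Real.exp r * x) ^ 2 / 2) := by
    rw [← Real.exp_add]; congr 1; ring
  rw [this]
  push_cast
  simp
  ring

/-- Identifies the factor in the moment recurrence with the variance; the sign of `A` originates
here. -/
theorem inv_sub_one_eq_neg_tanh (r : ℝ) : 1 / ((1 + Real.exp r ^ 2) / 2) - 1 = -Real.tanh r := by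
  have h : Real.exp r * Real.exp (-r) = 1 := by rw [← Real.exp_add]; simp
  have h1 := Real.exp_pos r
  have h2 := Real.exp_pos (-r)
  rw [Real.tanh_eq_sinh_div_cosh, Real.sinh_eq, Real.cosh_eq]
  have : Real.exp (-r) = (Real.exp r)⁻¹ := Real.exp_neg r
  rw [this]
  field_simp
  ring

/-- Normalised Fock coefficients of the squeezed vacuum are Gaussian moments. -/
theorem fockCoeff_squeezedVacuum_mul_sqrt_factorial (r : ℝ) (m : ℕ) :
    fockCoeff m (squeezedVacuum r) * (√(m ! : ℝ) : ℂ) =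
      ((√(Real.cosh r))⁻¹ : ℂ) * gaussianMoment (-(Real.tanh r : ℂ)) m := by
  have hb : 0 < (1 + Real.exp r ^ 2) / 2 := by positivity
  have key : fockCoeff m (squeezedVacuum r) * (√(m ! : ℝ) : ℂ) =
      (((√((2 : ℝ) ^ m))⁻¹ * (Real.exp (r / 2) * (√Real.pi)⁻¹) *
        hermiteMoment ((1 + Real.exp r ^ 2) / 2) m : ℝ) : ℂ) := by
    rw [fockCoeff_squeezedVacuum, ← Complex.ofReal_mul]
    congr 1
    rw [Real.sqrt_mul (by positivity), Real.sqrt_mul (by positivity)]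
    have h1 : √(m ! : ℝ) ≠ 0 := by positivity
    have h2 : √(√Real.pi) * √(√Real.pi) = √Real.pi := Real.mul_self_sqrt (by positivity)
    have h3 : √(√Real.pi) ≠ 0 := by have := Real.pi_pos; positivity
    have h4 : √Real.pi ≠ 0 := by have := Real.pi_pos; positivity
    calc _ = (√((2 : ℝ) ^ m))⁻¹ * (Real.exp (r / 2) * (√(√Real.pi) * √(√Real.pi))⁻¹) *
          hermiteMoment ((1 + Real.exp r ^ 2) / 2) m := by field_simp
      _ = _ := by rw [h2]
  rw [key]
  clear key
  induction m using Nat.twoStepInduction with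
  | zero =>
    rw [hermiteMoment_zero, gaussianMoment, mul_one, ← Complex.ofReal_inv]
    congr 1
    have hpi : √Real.pi ≠ 0 := by have := Real.pi_pos; positivity
    -- With `b = e^r cosh r`, the squeezing factor `e^{r/2}` cancels against `√b` and leaves
    -- `1/√(cosh r)`.
    have hc : (1 + Real.exp r ^ 2) / 2 = Real.exp r * Real.cosh r := by
      rw [Real.cosh_eq, Real.exp_neg]
      have := Real.exp_pos r
      field_simp
      ring
    have he : Real.exp (r / 2) = √(Real.exp r) := (Real.exp_half r)
    have hcc : √(Real.cosh r) ≠ 0 := by have := Real.cosh_pos r; positivity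
    have hee : √(Real.exp r) ≠ 0 := by positivity
    rw [Real.sqrt_div Real.pi_pos.le, hc, Real.sqrt_mul (Real.exp_pos r).le, he]
    simp
    field_simp
  | one => simp [hermiteMoment_one hb, gaussianMoment]
  | more m h0 _ =>
    rw [hermiteMoment_add_two hb, inv_sub_one_eq_neg_tanh, gaussianMoment]
    -- This 2 cancels the 2 in the Hermite moment recurrence.
    have h2 : √((2 : ℝ) ^ (m + 2)) = 2 * √((2 : ℝ) ^ m) := by
      rw [pow_add, mul_comm, Real.sqrt_mul (by positivity), Real.sqrt_sq (by norm_num)]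
    rw [h2]
    calc _ = ((m : ℂ) + 1) * (-(Real.tanh r : ℂ)) * (((√((2 : ℝ) ^ m))⁻¹ *
          (Real.exp (r / 2) * (√Real.pi)⁻¹) *
          hermiteMoment ((1 + Real.exp r ^ 2) / 2) m : ℝ) : ℂ) := by
          push_cast
          rw [mul_inv]
          ring
      _ = _ := by rw [h0]; ring

/-! ## Wick's theorem -/

theorem derivation_prod [DecidableEq ι] {R A : Type*} [CommSemiring R] [CommSemiring A]
    [Algebra R A] (D : Derivation R A A) (S : Finset ι) (f : ι → A) :
    D (∏ i ∈ S, f i) = ∑ i ∈ S, (∏ j ∈ S.erase i, f j) * D (f i) := by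
  induction S using Finset.induction_on with
  | empty => simp
  | insert a S ha ih =>
    rw [Finset.prod_insert ha, D.leibniz, ih, Finset.sum_insert ha, Finset.erase_insert ha, add_comm,
      smul_eq_mul, smul_eq_mul, Finset.mul_sum]
    congr 1
    refine Finset.sum_congr rfl fun i hi => ?_
    have hai : a ≠ i := fun h => ha (h ▸ hi)
    rw [Finset.erase_insert_of_ne hai, Finset.prod_insert (fun h => ha (Finset.mem_of_mem_erase h)),
      mul_assoc]

/-- The expectation of a polynomial in independent centred Gaussian variables of variances `c j`. -/
def gaussianExpectation [Fintype κ] (c : κ → ℂ) : MvPolynomial κ ℂ →ₗ[ℂ] ℂ :=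
  (MvPolynomial.basisMonomials κ ℂ).constr ℂ fun m => ∏ j, gaussianMoment (c j) (m j)

theorem gaussianExpectation_monomial [Fintype κ] (c : κ → ℂ) (m : κ →₀ ℕ) (z : ℂ) :
    gaussianExpectation c (MvPolynomial.monomial m z) = z * ∏ j, gaussianMoment (c j) (m j) := by
  have h : MvPolynomial.monomial m z = z • MvPolynomial.basisMonomials κ ℂ m := by
    simp [MvPolynomial.smul_monomial]
  rw [h, map_smul, gaussianExpectation, Module.Basis.constr_basis, smul_eq_mul]

/-- One-variable integration by parts. At `m = 0` the truncated `m - 1` is harmless, since the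
factor `m` vanishes. -/
theorem gaussianMoment_succ (c : ℂ) (m : ℕ) :
    gaussianMoment c (m + 1) = c * (m * gaussianMoment c (m - 1)) := by
  cases m with
  | zero => simp [gaussianMoment]
  | succ m => simp only [gaussianMoment, Nat.add_sub_cancel]; push_cast; ring

/-- Gaussian integration by parts. -/
theorem gaussianExpectation_X_mul [Fintype κ] (c : κ → ℂ) (j : κ) (p : MvPolynomial κ ℂ) :
    gaussianExpectation c (MvPolynomial.X j * p) =
      c j * gaussianExpectation c (MvPolynomial.pderiv j p) := by
  classical
  induction p using MvPolynomial.induction_on' with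
  | add p q hp hq => rw [mul_add, map_add, hp, hq, map_add, map_add, mul_add]
  | monomial m z =>
    rw [MvPolynomial.X, MvPolynomial.monomial_mul, MvPolynomial.pderiv_monomial,
      gaussianExpectation_monomial, gaussianExpectation_monomial,
      ← Finset.mul_prod_erase _ _ (Finset.mem_univ j),
      ← Finset.mul_prod_erase (a := j) _ (fun i => gaussianMoment (c i) ((m - fun₀ | j => 1) i))
        (Finset.mem_univ j)]
    have h1 : ∏ i ∈ Finset.univ.erase j, gaussianMoment (c i) (((fun₀ | j => 1) + m) i) =
        ∏ i ∈ Finset.univ.erase j, gaussianMoment (c i) (m i) :=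
      Finset.prod_congr rfl fun i hi => by simp [(Finset.ne_of_mem_erase hi).symm]
    have h2 : ∏ i ∈ Finset.univ.erase j, gaussianMoment (c i) ((m - fun₀ | j => 1) i) =
        ∏ i ∈ Finset.univ.erase j, gaussianMoment (c i) (m i) :=
      Finset.prod_congr rfl fun i hi => by simp [(Finset.ne_of_mem_erase hi).symm]
    rw [h1, h2]
    simp only [Finsupp.add_apply, Finsupp.single_eq_same, Finsupp.tsub_apply]
    rw [add_comm 1 (m j), gaussianMoment_succ]
    ring

/-- The linear form `∑ⱼ vⱼ Xⱼ`. -/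
def linearForm [Fintype κ] (v : κ → ℂ) : MvPolynomial κ ℂ :=
  ∑ j, MvPolynomial.C (v j) * MvPolynomial.X j

theorem pderiv_linearForm [Fintype κ] (v : κ → ℂ) (j : κ) :
    MvPolynomial.pderiv j (linearForm v) = MvPolynomial.C (v j) := by
  classical
  simp [linearForm, MvPolynomial.pderiv_X, Pi.single_apply]

/-- Wick's theorem: Gaussian moments of linear forms are hafnians of the covariance matrix. -/
theorem gaussianExpectation_prod_linearForm [LinearOrder ι] [Fintype κ] (c : κ → ℂ)
    (V : ι → κ → ℂ) {A : Matrix ι ι ℂ} (hA : ∀ a b, A a b = ∑ j, V a j * c j * V b j)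
    (S : Finset ι) :
    gaussianExpectation c (∏ i ∈ S, linearForm (V i)) = hafnianOn A S := by
  induction S using Finset.strongInduction with
  | H S ih =>
    rcases S.eq_empty_or_nonempty with rfl | ⟨a, ha⟩
    · rw [hafnianOn_empty, Finset.prod_empty, ← MvPolynomial.C_1, MvPolynomial.C_apply,
        gaussianExpectation_monomial]
      simp [gaussianMoment]
    · have hsym : ∀ a b, A a b = A b a := fun a b => by
        rw [hA, hA]
        exact Finset.sum_congr rfl fun j _ => by ring
      have hC : ∀ (z : ℂ) (p : MvPolynomial κ ℂ),
          gaussianExpectation c (MvPolynomial.C z * p) = z * gaussianExpectation c p :=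
        fun z p => by rw [← MvPolynomial.smul_eq_C_mul, map_smul, smul_eq_mul]
      have hE : ∀ b, (S.erase a).erase b = S \ {a, b} := fun b => by
        ext x; simp only [Finset.mem_erase, Finset.mem_sdiff, Finset.mem_insert,
          Finset.mem_singleton]; tauto
      rw [hafnianOn_eq_sum hsym ha, ← Finset.mul_prod_erase _ _ ha]
      -- Only the factor of row `a` is expanded. Integration by parts against each `X j`
      -- differentiates the other factors, whose derivatives are constants; summing over `j`
      -- assembles `A a b`, which matches the row expansion of the hafnian.
      nth_rw 1 [linearForm]
      simp_rw [Finset.sum_mul, map_sum, mul_assoc, hC, gaussianExpectation_X_mul, derivation_prod,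
        pderiv_linearForm, map_sum, mul_comm _ (MvPolynomial.C _), hC, hE, Finset.mul_sum]
      rw [Finset.sum_comm]
      refine Finset.sum_congr rfl fun b _ => ?_
      rw [← ih (S \ {a, b}) ⟨Finset.sdiff_subset, fun h => by simpa using h ha⟩, hA, Finset.sum_mul]
      exact Finset.sum_congr rfl fun j _ => by ring

/-- Expanding the product of linear forms picks one variable per factor, that is, a map `f`; the
exponent of `X j` is the size of the fibre of `f` over `j`. -/
theorem sum_prod_mul_gaussianMoment_eq_hafnian [Fintype ι] [LinearOrder ι] [Fintype κ]
    [DecidableEq κ] (c : κ → ℂ) (V : ι → κ → ℂ) {A : Matrix ι ι ℂ}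
    (hA : ∀ a b, A a b = ∑ j, V a j * c j * V b j) :
    ∑ f : ι → κ, (∏ i, V i (f i)) * ∏ j, gaussianMoment (c j) (∑ i, if f i = j then 1 else 0) =
      hafnian A := by
  rw [hafnian_eq_hafnianOn, ← gaussianExpectation_prod_linearForm c V hA]
  simp_rw [linearForm]
  rw [Finset.prod_univ_sum, map_sum, Fintype.piFinset_univ]
  refine Finset.sum_congr rfl fun f _ => ?_
  have : ∏ i, MvPolynomial.C (V i (f i)) * MvPolynomial.X (f i) =
      MvPolynomial.monomial (∑ i, Finsupp.single (f i) 1) (∏ i, V i (f i)) := by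
    rw [MvPolynomial.monomial_sum_index, Finset.prod_mul_distrib, ← map_prod]
    rfl
  rw [this, gaussianExpectation_monomial]
  congr 1
  refine Finset.prod_congr rfl fun j _ => ?_
  rw [Finsupp.finsetSum_apply]
  simp [Finsupp.single_apply]

/-! ## The contraction of the circuit -/

variable {s : ℕ} {n : Fin s → ℕ}

/-- The number of photons on the edge from input `j` to output `i` when each detected photon `i`
comes from the input `f i`. -/
def edgeCount (f : {i : Fin s // n i ≠ 0} → Fin s) (i j : Fin s) : ℕ :=
  if h : n i ≠ 0 then (if f ⟨i, h⟩ = j then 1 else 0) else 0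

/-- The labelling of the internal wires in which each detected photon `i` comes from the
input `f i`. -/
def assignmentLabels (f : {i : Fin s // n i ≠ 0} → Fin s) : WireLabels s where
  input j := ∑ i, edgeCount f i j
  pre := edgeCount f
  post := edgeCount f

theorem assignmentLabels_injective :
    Function.Injective (assignmentLabels : ({i : Fin s // n i ≠ 0} → Fin s) → WireLabels s) := by
  intro f g h
  funext ⟨i, hi⟩
  have : edgeCount f i (g ⟨i, hi⟩) = edgeCount g i (g ⟨i, hi⟩) :=
    congrFun (congrFun (congrArg WireLabels.pre h) i) _
  by_contra hne
  simp [edgeCount, hi, hne] at this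

theorem exists_eq_ite_of_sum_eq_one {κ : Type*} [Fintype κ] [DecidableEq κ] {k : κ → ℕ}
    (hk : ∑ j, k j = 1) : ∃ a, ∀ j, k j = if a = j then 1 else 0 := by
  obtain ⟨a, -, ha⟩ := Finset.exists_ne_zero_of_sum_ne_zero (hk.trans_ne one_ne_zero)
  rw [← Finset.add_sum_erase _ _ (Finset.mem_univ a)] at hk
  have h0 : ∑ j ∈ Finset.univ.erase a, k j = 0 := by omega
  refine ⟨a, fun j => ?_⟩
  split_ifs with h
  · subst h; omega
  · exact Finset.sum_eq_zero_iff.1 h0 j (Finset.mem_erase.2 ⟨Ne.symm h, Finset.mem_univ j⟩)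

/-- Naturals summing to 1 form an indicator, and those summing to 0 vanish; this is where counts of
at most one photon matter. -/
theorem exists_eq_edgeCount (hn : ∀ i, n i = 0 ∨ n i = 1) {k : Fin s → Fin s → ℕ}
    (hk : ∀ i, n i = ∑ j, k i j) : ∃ f : {i : Fin s // n i ≠ 0} → Fin s, k = edgeCount f := by
  have h1 : ∀ i : {i : Fin s // n i ≠ 0}, ∃ a, ∀ j, k i j = if a = j then 1 else 0 := fun i =>
    exists_eq_ite_of_sum_eq_one ((hk i).symm.trans ((hn i).resolve_left i.2))
  choose f hf using h1
  refine ⟨f, ?_⟩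
  funext i j
  unfold edgeCount
  split_ifs with h hj
  · rw [hf ⟨i, h⟩ j, if_pos hj]
  · rw [hf ⟨i, h⟩ j, if_neg hj]
  · exact Finset.sum_eq_zero_iff.1 ((hk i).symm.trans (not_not.1 h)) j (Finset.mem_univ j)

theorem eq_sum_of_wNode_ne_zero {ι : Type*} [Fintype ι] {N : ℕ} {k : ι → ℕ}
    (h : wNode N k ≠ 0) : N = ∑ i, k i := by
  by_contra hne
  exact h (if_neg hne)

/-- Only the labellings that trace each detected photon back to an input contribute. -/
theorem mem_range_assignmentLabels (hn : ∀ i, n i = 0 ∨ n i = 1) (U : Matrix (Fin s) (Fin s) ℂ)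
    (r : Fin s → ℝ) {w : WireLabels s} (hw : gbsTerm U r n w ≠ 0) :
    w ∈ Set.range (assignmentLabels : ({i : Fin s // n i ≠ 0} → Fin s) → WireLabels s) := by
  simp only [gbsTerm, ne_eq, mul_eq_zero, not_or, Finset.prod_eq_zero_iff, not_exists, not_and,
    Finset.mem_univ, true_implies] at hw
  obtain ⟨⟨⟨-, hin⟩, hmid⟩, hout⟩ := hw
  have hpost : w.post = w.pre := by
    funext i j
    by_contra h
    exact hmid i j (if_neg h)
  obtain ⟨f, hf⟩ := exists_eq_edgeCount hn fun i => eq_sum_of_wNode_ne_zero (hout i)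
  refine ⟨f, ?_⟩
  obtain ⟨input, pre, post⟩ := w
  obtain rfl : post = pre := hpost
  obtain rfl : post = edgeCount f := hf
  have : input = fun j => ∑ i, edgeCount f i j := funext fun j => eq_sum_of_wNode_ne_zero (hin j)
  rw [this]
  rfl

theorem factorial_edgeCount (f : {i : Fin s // n i ≠ 0} → Fin s) (i j : Fin s) :
    (edgeCount f i j)! = 1 := by
  unfold edgeCount
  split_ifs <;> rfl

theorem sum_edgeCount (f : {i : Fin s // n i ≠ 0} → Fin s) (j : Fin s) :
    ∑ i, edgeCount f i j = ∑ i, if f i = j then 1 else 0 := by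
  symm
  refine Fintype.sum_of_injective Subtype.val Subtype.val_injective _ _ (fun i hi => ?_)
    (fun i => ?_)
  · have : ¬ n i ≠ 0 := fun h => hi ⟨⟨i, h⟩, rfl⟩
    simp [edgeCount, this]
  · simp [edgeCount, i.2]

theorem prod_pow_edgeCount (U : Matrix (Fin s) (Fin s) ℂ)
    (f : {i : Fin s // n i ≠ 0} → Fin s) :
    ∏ i, ∏ j, U i j ^ edgeCount f i j = ∏ i : {i : Fin s // n i ≠ 0}, U i (f i) := by
  symm
  refine Fintype.prod_of_injective Subtype.val Subtype.val_injective _ _ (fun i hi => ?_)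
    (fun i => ?_)
  · have : ¬ n i ≠ 0 := fun h => hi ⟨⟨i, h⟩, rfl⟩
    simp [edgeCount, this]
  · simp [edgeCount, i.2, pow_ite]

theorem wNode_output (hn : ∀ i, n i = 0 ∨ n i = 1) (f : {i : Fin s // n i ≠ 0} → Fin s)
    (i : Fin s) : wNode (n i) (fun j => edgeCount f i j) = 1 := by
  have h1 : (n i)! = 1 := by rcases hn i with h | h <;> rw [h] <;> rfl
  have h2 : n i = ∑ j, edgeCount f i j := by
    rcases hn i with h | h <;> simp [edgeCount, h]
  rw [wNode, if_pos h2]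
  simp [factorial_edgeCount, h1]

theorem gbsTerm_assignmentLabels (hn : ∀ i, n i = 0 ∨ n i = 1) (U : Matrix (Fin s) (Fin s) ℂ)
    (r : Fin s → ℝ) (f : {i : Fin s // n i ≠ 0} → Fin s) :
    gbsTerm U r n (assignmentLabels f) =
      (∏ j, ((√(Real.cosh (r j)))⁻¹ : ℂ)) * ((∏ i : {i : Fin s // n i ≠ 0}, U i (f i)) *
        ∏ j, gaussianMoment (-(Real.tanh (r j) : ℂ)) (∑ i, if f i = j then 1 else 0)) := by
  have hin : ∀ j, wNode (∑ i, edgeCount f i j) (fun i => edgeCount f i j) =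
      (√((∑ i, edgeCount f i j)! : ℝ) : ℂ) := fun j => by
    rw [wNode, if_pos rfl]
    simp [factorial_edgeCount]
  simp only [gbsTerm, assignmentLabels, fockSpider, if_true, hin, wNode_output hn,
    Finset.prod_const_one, mul_one, prod_pow_edgeCount]
  -- Pairs each Fock coefficient with the `√(m!)` of its own input W node.
  rw [← Finset.prod_mul_distrib]
  simp_rw [fockCoeff_squeezedVacuum_mul_sqrt_factorial, sum_edgeCount]
  rw [Finset.prod_mul_distrib]
  ring

theorem deleteZero_gbsMatrix_apply (U : Matrix (Fin s) (Fin s) ℂ) (r : Fin s → ℝ)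
    (n : Fin s → ℕ) (a b : {i : Fin s // n i ≠ 0}) :
    deleteZero (gbsMatrix U r) n a b = ∑ j, U a j * -(Real.tanh (r j) : ℂ) * U b j := by
  simp [deleteZero, gbsMatrix, Matrix.mul_apply, Matrix.diagonal_apply]

end GBS

end

theorem mainTheorem4 (s : ℕ) (U : Matrix (Fin s) (Fin s) ℂ)
    (hU : U ∈ Matrix.unitaryGroup (Fin s) ℂ) (r : Fin s → ℝ)
    (n : Fin s → ℕ) (hn : ∀ i, n i = 0 ∨ n i = 1) :
    Summable (GBS.gbsTerm U r n) ∧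
    GBS.gbsAmplitude U r n =
      (∏ j, ((Real.sqrt (Real.cosh (r j)))⁻¹ : ℂ)) *
        GBS.hafnian (GBS.deleteZero (GBS.gbsMatrix U r) n) := by
  have hsupp : Function.support (GBS.gbsTerm U r n) ⊆ Set.range GBS.assignmentLabels :=
    fun w hw => GBS.mem_range_assignmentLabels hn U r hw
  -- The support lies in the image of the finite set of maps `f`; injectivity then turns the series
  -- into a sum over these maps.
  refine ⟨summable_of_hasFiniteSupport ((Set.finite_range _).subset hsupp), ?_⟩
  rw [GBS.gbsAmplitude, ← GBS.assignmentLabels_injective.tsum_eq hsupp, tsum_fintype]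
  simp_rw [GBS.gbsTerm_assignmentLabels hn]
  rw [← Finset.mul_sum, ← GBS.sum_prod_mul_gaussianMoment_eq_hafnian _ _
    (GBS.deleteZero_gbsMatrix_apply U r n)]
  congr!
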